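/- Let $T\subset\mathbb{E}^3$ be the regular tetrahedron with vertices $(1,1,-1)$, $(1,-1,1)$, $(-1,1,1)$, $(-1,-1,-1)$, and let $T_3$ be a regular tetrahedron with unit edges. For $K\in\{T,T_3\}$ and a set $X\subseteq\mathbb{E}^3$, the family $K+X=\{K+\mathbf{x}:\mathbf{x}\in X\}$ is called a translative covering of $\mathbb{E}^3$ if $\bigcup_{\mathbf{x}\in X}(K+\mathbf{x})=\mathbb{E}^3$; its density is $$\liminf_{r\to\infty}\frac{1}{\mathrm{vol}(B_r)}\sum_{\mathbf{x}\in X}\mathrm{vol}\bigl(B_r\cap(K+\mathbf{x})\bigr)\in[0,\infty],$$ where $B_r$ is the ball of radius $r$ centered at the origin. Let $\theta^t(K)$ be the infimum of the densities of all translative coverings $K+X$ of $\mathbb{E}^3$. Then every translative covering $T+X$ of $\mathbb{E}^3$ has density at least $1+\frac{\sqrt2}{1152}$. Consequently $$\theta^t(T_3)=\theta^t(T)\ \geq\ 1+\frac{\sqrt2}{1152}\ >\ 1+1.227\times10^{-3}.$$ -/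

import Mathlib

open scoped Pointwise

/-- `K + X` is a translative covering of `ℝⁿ`: the translates `K + x`, `x ∈ X`, cover the space. -/
def IsTranslativeCovering {n : ℕ} (K X : Set (EuclideanSpace ℝ (Fin n))) : Prop :=
  (⋃ x ∈ X, (x +ᵥ K)) = Set.univ

/-- The density of the system of translates `K + x`, `x ∈ X`, relative to a set `D`:
the sum over `x ∈ X` of `vol (D ∩ (K + x))`, divided by `vol D`. -/
noncomputable def relativeDensity {n : ℕ} (K X D : Set (EuclideanSpace ℝ (Fin n))) : ENNReal :=
  (∑' x : X, MeasureTheory.volume (D ∩ ((x : EuclideanSpace ℝ (Fin n)) +ᵥ K))) /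
    MeasureTheory.volume D

/-- The (lower) density of the system of translates `K + x`, `x ∈ X`: the lower limit of its density
relative to the ball of radius `r` about the origin, as `r → ∞`. It is `∞` when infinitely many
points of `X` lie in a bounded region and `K` has positive volume. -/
noncomputable def translativeDensity {n : ℕ} (K X : Set (EuclideanSpace ℝ (Fin n))) : ENNReal :=
  Filter.liminf (fun r : ℝ => relativeDensity K X (Metric.closedBall 0 r)) Filter.atTop

/-- The translative covering density of `K`: the infimum of the densities of the
translative coverings of `ℝⁿ` with `K`. -/
noncomputable def translativeCoveringDensity {n : ℕ} (K : Set (EuclideanSpace ℝ (Fin n))) :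
    ENNReal :=
  ⨅ (X : Set (EuclideanSpace ℝ (Fin n))) (_ : IsTranslativeCovering K X), translativeDensity K X

/-- `S` is an `n`-dimensional regular simplex with unit edges in `ℝⁿ`. -/
def IsUnitRegularSimplex {n : ℕ} (S : Set (EuclideanSpace ℝ (Fin n))) : Prop :=
  ∃ v : Fin (n + 1) → EuclideanSpace ℝ (Fin n),
    (∀ i j, i ≠ j → dist (v i) (v j) = 1) ∧ S = convexHull ℝ (Set.range v)

/-- The regular tetrahedron with vertices `(1,1,-1)`, `(1,-1,1)`, `(-1,1,1)`, `(-1,-1,-1)`. -/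
noncomputable def tetrahedronT : Set (EuclideanSpace ℝ (Fin 3)) :=
  convexHull ℝ {!₂[1, 1, -1], !₂[1, -1, 1], !₂[-1, 1, 1], !₂[-1, -1, -1]}

/-!
Coverings by translates of a simplex, and their densities, behave well under linear maps, so the
problem is transferred to the corner simplex `Δ = {p | p ≥ 0, p₀ + p₁ + p₂ ≤ 1}`. A translate
`x + Δ` is described by the coordinatewise order and the height `h(p) = p₀ + p₁ + p₂`:
a point `p` lies in it iff `p ≥ x` and `h(p) ≤ h(x) + 1`.

The slanted face of `x + Δ` lies at height `h(x) + 1`. Space just above it has to be covered by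
simplices of the same orientation, which reach below the face with a tip. Let `p` lie at height
`h(x) + 1 + τ`, where `τ > 1/14`, and not too close to the sides of `x + Δ`, and let `q₀, q₁, q₂`
be obtained from `p` by lowering one coordinate by `(1/7 + τ)/3 < τ`. The simplices covering the
`q_j` have higher apices than `x`. If they all reach up to `p`, then either two of them are distinct
and `p` is covered twice, or they coincide and the common simplex has a tip of scale at least `1/7`
in `x + Δ`; and a simplex which ends below `p` is almost at the level of `x`, whence its
intersection with `x + Δ` is either large or close to a side. This dichotomy is
`overlap_or_covered_twice`, with threshold scale `1/7`: either a higher translate meets `x + Δ` in a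
simplex of scale at least `1/7`, or every point of `x + doubleRegion` is covered twice.

Let `E` be the integral of (multiplicity − 1). At each point, the translates lying there below
another one of greater apex height number at most multiplicity − 1, since one of maximal height is
not counted; hence the translates of the first kind occupy a volume of at most `7³ E`. If `W` is
the region occupied by those of the second kind, then every point `w ∈ W` has a set of doubly
covered points of volume at least `9/1372` within the cube `w + [-11/14, 9/14]³` of volume
`(10/7)³`. By Fubini, `vol W ≤ (4000/9) E`. As the two regions exhaust space, the density is at
least `1 + 1 / (343 + 4000/9) = 1 + 9/7087`, slightly more than `1 + √2/1152`
(`volume_mul_le_tsum_volume_inter`).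

Finally, any two regular tetrahedra are similar, and a similarity preserves the translative covering
density (`translativeCoveringDensity_image`).
-/

open MeasureTheory Set Filter
open scoped Pointwise ENNReal

/-! ### The corner simplex and its translates -/

/-- The sum of the coordinates. -/
def height (p : EuclideanSpace ℝ (Fin 3)) : ℝ := p 0 + p 1 + p 2

/-- The simplex with vertices at the origin and the three standard basis vectors. -/
def cornerSimplex : Set (EuclideanSpace ℝ (Fin 3)) := {p | (∀ i, 0 ≤ p i) ∧ height p ≤ 1}

/-- The points `v` at height `1 + τ` with `τ > 1/14` all of whose coordinates are at least
`1/7 + τ`: a simplex above the slanted face of `cornerSimplex`, with its apex `(3/7, 3/7, 3/7)` at the top and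
its base at height `15/14`. -/
def doubleRegion : Set (EuclideanSpace ℝ (Fin 3)) :=
  {v | (∀ i, height v - 6 / 7 ≤ v i) ∧ 15 / 14 < height v}

/-- The part of `x + cornerSimplex` covered by translates with an apex strictly higher than `x`. -/
def overlapped (X : Set (EuclideanSpace ℝ (Fin 3))) (x : EuclideanSpace ℝ (Fin 3)) :
    Set (EuclideanSpace ℝ (Fin 3)) :=
  (x +ᵥ cornerSimplex) ∩ {p | ∃ y ∈ X, height x < height y ∧ p ∈ y +ᵥ cornerSimplex}

theorem height_sub (p q : EuclideanSpace ℝ (Fin 3)) : height (p - q) = height p - height q := by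
  simp [height]; ring

theorem mem_vadd_cornerSimplex {x p : EuclideanSpace ℝ (Fin 3)} :
    p ∈ x +ᵥ cornerSimplex ↔ (∀ i, x i ≤ p i) ∧ height p ≤ height x + 1 := by
  rw [Set.mem_vadd_set_iff_neg_vadd_mem]
  simp only [cornerSimplex, mem_ofPred_eq, vadd_eq_add, neg_add_eq_sub, height_sub, PiLp.sub_apply,
    sub_nonneg, sub_le_iff_le_add']

theorem isClosed_cornerSimplex : IsClosed cornerSimplex := by
  have : cornerSimplex = (⋂ i, {p | 0 ≤ p i}) ∩ {p | height p ≤ 1} := by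
    ext p; simp [cornerSimplex]
  rw [this]
  refine (isClosed_iInter fun i => isClosed_le continuous_const (by fun_prop)).inter
    (isClosed_le ?_ continuous_const)
  unfold height; fun_prop

theorem measurableSet_vadd_cornerSimplex (x : EuclideanSpace ℝ (Fin 3)) :
    MeasurableSet (x +ᵥ cornerSimplex) :=
  (isClosed_cornerSimplex.vadd x).measurableSet

/-! ### Large overlaps or doubly covered points -/

/-- If the unit cube with least corner `x` is covered and `v ∈ doubleRegion`, then either some
translate with a higher apex `y` meets `x + cornerSimplex` in a simplex of scale at least `1/7`
(its apex is the coordinatewise maximum of `x` and `y`), or `x + v` is covered by two different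
translates. -/
theorem overlap_or_covered_twice {X : Set (EuclideanSpace ℝ (Fin 3))}
    {x v : EuclideanSpace ℝ (Fin 3)}
    (hcov : ∀ q : EuclideanSpace ℝ (Fin 3), (∀ i, x i ≤ q i ∧ q i ≤ x i + 1) →
      ∃ y ∈ X, q ∈ y +ᵥ cornerSimplex)
    (hv : v ∈ doubleRegion) :
    (∃ y ∈ X, height x < height y ∧
      max (x 0) (y 0) + max (x 1) (y 1) + max (x 2) (y 2) ≤ height x + 6 / 7) ∨
    ∃ y ∈ X, ∃ y' ∈ X, y ≠ y' ∧ x + v ∈ y +ᵥ cornerSimplex ∧ x + v ∈ y' +ᵥ cornerSimplex := by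
  obtain ⟨hv1, hv2⟩ := hv
  by_contra! hcon
  obtain ⟨hA, hB⟩ := hcon
  obtain ⟨τ, hτ⟩ : ∃ τ, τ = height v - 1 := ⟨_, rfl⟩
  -- For `τ' = (1/7 + τ) / 3`, an apex below `x + v - τ' • (1, 1, 1)` gives a tip of scale
  -- at least `3τ' - τ = 1/7`; and `τ' < τ` because `τ > 1/14`.
  obtain ⟨τ', hτ'⟩ : ∃ τ', τ' = (1 / 7 + τ) / 3 := ⟨_, rfl⟩
  have h0 := hv1 0
  have h1 := hv1 1
  have h2 := hv1 2
  have hhv : height v = v 0 + v 1 + v 2 := rfl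
  -- Lower the `j`-th coordinate of `x + v` by `τ'`, and cover the resulting point.
  have key : ∀ j : Fin 3, ∃ y ∈ X, height x < height y ∧ x + v ∈ y +ᵥ cornerSimplex ∧
      y j ≤ x j + v j - τ' := by
    intro j
    obtain ⟨q, hq⟩ : ∃ q, q = x + v - EuclideanSpace.single j τ' := ⟨_, rfl⟩
    have hqi : ∀ i, q i = x i + v i - if i = j then τ' else 0 := by
      intro i; rw [hq]; simp
    have hqh : height q = height x + height v - τ' := by
      simp only [height, hqi]
      fin_cases j <;> simp <;> ring
    have hq2 : ∀ i, x i + (height v - 6 / 7) - τ' ≤ q i ∧ q i ≤ x i + v i := by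
      intro i
      rw [hqi]
      have := hv1 i
      split_ifs <;> constructor <;> linarith
    obtain ⟨y, hyX, hy⟩ := hcov q (by
      intro i
      have := hq2 i
      fin_cases i <;> simp at this ⊢ <;> constructor <;> linarith)
    rw [mem_vadd_cornerSimplex] at hy
    obtain ⟨hy1, hy2⟩ := hy
    have hxy : height x < height y := by linarith
    have hA' := hA y hyX hxy
    refine ⟨y, hyX, hxy, ?_, ?_⟩
    · rw [mem_vadd_cornerSimplex]
      refine ⟨fun i => (hy1 i).trans ((hq2 i).2.trans_eq (by simp)), ?_⟩
      -- Otherwise `h(y) - h(x) < τ`. The intersection with `x + cornerSimplex` has scale below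
      -- `1/7`, so some coordinate of `y` is less than that of `x`; but then `q` is too far from this side.
      by_contra! hlt
      have hadd : height (x + v) = height x + height v := by simp [height]; ring
      rw [hadd] at hlt
      have a0 := hq2 0
      have a1 := hq2 1
      have a2 := hq2 2
      have b0 := hy1 0
      have b1 := hy1 1
      have b2 := hy1 2
      have hhx : height x = x 0 + x 1 + x 2 := rfl
      have hhy : height y = y 0 + y 1 + y 2 := rfl
      have hhq : height q = q 0 + q 1 + q 2 := rfl
      rcases le_total (x 0) (y 0) with c0 | c0 <;> rcases le_total (x 1) (y 1) with c1 | c1 <;>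
      rcases le_total (x 2) (y 2) with c2 | c2 <;>
      simp only [c0, c1, c2, max_eq_left, max_eq_right] at hA' <;> linarith
    · have := hy1 j
      rw [hqi] at this
      simpa using this
  choose y hyX hyh hyp hyj using key
  have e1 : y 1 = y 0 := by
    by_contra h
    exact hB _ (hyX 1) _ (hyX 0) h (hyp 1) (hyp 0)
  have e2 : y 2 = y 0 := by
    by_contra h
    exact hB _ (hyX 2) _ (hyX 0) h (hyp 2) (hyp 0)
  have hA' := hA _ (hyX 0) (hyh 0)
  have j0 := hyj 0
  have j1 := hyj 1
  have j2 := hyj 2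
  rw [e1] at j1
  rw [e2] at j2
  have m0 := max_le (a := x 0) (by linarith) j0
  have m1 := max_le (a := x 1) (by linarith) j1
  have m2 := max_le (a := x 2) (by linarith) j2
  have hhx : height x = x 0 + x 1 + x 2 := rfl
  linarith

theorem volume_overlapped {X : Set (EuclideanSpace ℝ (Fin 3))} {x y : EuclideanSpace ℝ (Fin 3)}
    (hy : y ∈ X) (hxy : height x < height y)
    (hmax : max (x 0) (y 0) + max (x 1) (y 1) + max (x 2) (y 2) ≤ height x + 6 / 7) :
    volume cornerSimplex ≤ 343 * volume (overlapped X x) := by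
  let z : EuclideanSpace ℝ (Fin 3) := !₂[max (x 0) (y 0), max (x 1) (y 1), max (x 2) (y 2)]
  have hz : ∀ i, z i = max (x i) (y i) := by
    intro i; fin_cases i <;> simp [z]
  have hsub : z +ᵥ ((1 / 7 : ℝ) • cornerSimplex) ⊆ overlapped X x := by
    rintro _ ⟨_, ⟨u, ⟨hu, hu1⟩, rfl⟩, rfl⟩
    have h0 : height (z + (1 / 7 : ℝ) • u) ≤ height x + 1 := by
      simp only [height, PiLp.add_apply, PiLp.smul_apply, smul_eq_mul, hz] at hu1 hmax ⊢
      linarith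
    have h1 : ∀ i, max (x i) (y i) ≤ (z + (1 / 7 : ℝ) • u) i := by
      intro i
      simp only [PiLp.add_apply, PiLp.smul_apply, smul_eq_mul, hz]
      have := hu i
      linarith
    refine ⟨mem_vadd_cornerSimplex.2 ⟨fun i => (le_max_left _ _).trans (h1 i), h0⟩, y, hy, hxy,
      mem_vadd_cornerSimplex.2 ⟨fun i => (le_max_right _ _).trans (h1 i), ?_⟩⟩
    exact h0.trans (by linarith)
  have hvol := measure_mono (μ := volume) hsub
  rw [measure_vadd, Measure.addHaar_smul] at hvol
  simp only [finrank_euclideanSpace, Fintype.card_fin] at hvol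
  calc volume cornerSimplex
      = 343 * (ENNReal.ofReal |(1 / 7 : ℝ) ^ 3| * volume cornerSimplex) := by
        rw [← mul_assoc]
        have : (343 : ℝ≥0∞) = ENNReal.ofReal 343 := by norm_num
        rw [this, ← ENNReal.ofReal_mul (by norm_num)]
        norm_num [abs_of_pos]
    _ ≤ _ := by gcongr

theorem measurableSet_overlapped {X : Set (EuclideanSpace ℝ (Fin 3))} (hX : X.Countable)
    (x : EuclideanSpace ℝ (Fin 3)) : MeasurableSet (overlapped X x) := by
  refine (measurableSet_vadd_cornerSimplex x).inter ?_
  have : {p | ∃ y ∈ X, height x < height y ∧ p ∈ y +ᵥ cornerSimplex} =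
      ⋃ y ∈ X, ⋃ _ : height x < height y, y +ᵥ cornerSimplex := by
    ext; simp only [mem_ofPred_eq, mem_iUnion, exists_prop]
  rw [this]
  exact .biUnion hX fun y _ => .iUnion fun _ => measurableSet_vadd_cornerSimplex y

/-! ### Volumes -/

theorem volume_preimage_matrix (M : Matrix (Fin 3) (Fin 3) ℝ) (hM : M.det ≠ 0)
    (S : Set (EuclideanSpace ℝ (Fin 3))) :
    volume (M.toEuclideanLin ⁻¹' S) = ENNReal.ofReal |M.det⁻¹| * volume S := by
  have h : LinearMap.det (M.toEuclideanLin) = M.det := by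
    simp [Matrix.toEuclideanLin, LinearMap.det_toLpLin]
  rw [Measure.addHaar_preimage_linearMap _ (by rw [h]; exact hM), h]

theorem volume_box (a b : ℝ) :
    volume {p : EuclideanSpace ℝ (Fin 3) | ∀ i, p i ∈ Icc a b} = ENNReal.ofReal (b - a) ^ 3 := by
  have h := (PiLp.volume_preserving_ofLp (Fin 3)).measure_preimage
    (s := Icc (fun _ => a) (fun _ => b)) measurableSet_Icc.nullMeasurableSet
  rw [Real.volume_Icc_pi] at h
  simp only [Finset.prod_const, Finset.card_univ, Fintype.card_fin] at h
  rw [← h]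
  congr 1
  ext p
  simp [Pi.le_def, forall_and]

theorem volume_box_Ico (a b : ℝ) :
    volume {p : EuclideanSpace ℝ (Fin 3) | ∀ i, p i ∈ Ico a b} = ENNReal.ofReal (b - a) ^ 3 := by
  have h := (PiLp.volume_preserving_ofLp (Fin 3)).measure_preimage
    (s := Set.pi univ fun _ => Ico a b)
    (MeasurableSet.univ_pi fun _ => measurableSet_Ico).nullMeasurableSet
  rw [Real.volume_pi_Ico] at h
  simp only [Finset.prod_const, Finset.card_univ, Fintype.card_fin] at h
  rw [← h]
  congr 1
  ext p
  simp

/-- `cornerSimplex` without its slanted face, convenient since `doubleRegion` does not contain its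
base. -/
def halfOpenSimplex : Set (EuclideanSpace ℝ (Fin 3)) := {p | (∀ i, 0 ≤ p i) ∧ height p < 1}

/-- The half-open unit cube is covered by six copies of the half-open simplex, one for each ordering
of the coordinates; the matrices express successive differences of the sorted coordinates. -/
theorem one_le_volume_halfOpenSimplex : 1 ≤ 6 * volume halfOpenSimplex := by
  let M : Fin 6 → Matrix (Fin 3) (Fin 3) ℝ := ![
    !![1, -1, 0; 0, 1, -1; 0, 0, 1], !![1, 0, -1; 0, -1, 1; 0, 1, 0],
    !![-1, 1, 0; 1, 0, -1; 0, 0, 1], !![0, 1, -1; -1, 0, 1; 1, 0, 0],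
    !![-1, 0, 1; 1, -1, 0; 0, 1, 0], !![0, -1, 1; -1, 1, 0; 1, 0, 0]]
  have hdet : ∀ i, |(M i).det| = 1 := by
    intro i
    fin_cases i <;> simp [M, Matrix.det_fin_three]
  have hsub : {p : EuclideanSpace ℝ (Fin 3) | ∀ i, p i ∈ Ico (0 : ℝ) 1} ⊆
      ⋃ i, (M i).toEuclideanLin ⁻¹' halfOpenSimplex := by
    intro p hp
    simp only [mem_ofPred_eq, mem_Ico, Fin.forall_fin_succ] at hp
    simp only [mem_iUnion, Fin.exists_fin_succ, mem_preimage, halfOpenSimplex, mem_ofPred_eq,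
      Fin.forall_fin_succ, height, Matrix.toEuclideanLin, Matrix.toLpLin_apply, M]
    simp [Matrix.mulVec, dotProduct, Fin.sum_univ_three] at hp ⊢
    rcases le_total (p 0) (p 1) with h01 | h01 <;> rcases le_total (p 1) (p 2) with h12 | h12 <;>
    rcases le_total (p 0) (p 2) with h02 | h02 <;> grind
  calc (1 : ℝ≥0∞) = volume {p : EuclideanSpace ℝ (Fin 3) | ∀ i, p i ∈ Ico (0 : ℝ) 1} := by
        rw [volume_box_Ico]; simp
    _ ≤ ∑ i, volume ((M i).toEuclideanLin ⁻¹' halfOpenSimplex) :=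
        (measure_mono hsub).trans (measure_iUnion_fintype_le _ _)
    _ = 6 * volume halfOpenSimplex := by
        have : ∀ i, volume ((M i).toEuclideanLin ⁻¹' halfOpenSimplex) = volume halfOpenSimplex := by
          intro i
          have h := hdet i
          rw [volume_preimage_matrix _ (by intro h0; simp [h0] at h), abs_inv, h]
          simp
        simp [this]

/-- The affine map `v ↦ (7/3) (v - h(v) (1, 1, 1)) + (2, 2, 2)` has a linear part of determinant
`-686/27` and takes `doubleRegion` to the half-open simplex. -/
theorem volume_doubleRegion : ENNReal.ofReal (9 / 1372) ≤ volume doubleRegion := by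
  let M : Matrix (Fin 3) (Fin 3) ℝ :=
    !![0, -7/3, -7/3; -7/3, 0, -7/3; -7/3, -7/3, 0]
  have hdet : |M.det⁻¹| = 27 / 686 := by
    have h : M.det = -(686 / 27) := by
      simp [M, Matrix.det_fin_three]; norm_num
    rw [h]; norm_num [abs_of_neg]
  let c : EuclideanSpace ℝ (Fin 3) := !₂[2, 2, 2]
  have hsub : M.toEuclideanLin ⁻¹' ((-c) +ᵥ halfOpenSimplex) ⊆ doubleRegion := by
    intro p hp
    rw [mem_preimage, mem_vadd_set_iff_neg_vadd_mem] at hp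
    simp only [halfOpenSimplex, mem_ofPred_eq, doubleRegion,
      Fin.forall_fin_succ, height, Matrix.toEuclideanLin, Matrix.toLpLin_apply, M, c] at hp ⊢
    simp [dotProduct, Fin.sum_univ_three] at hp ⊢
    obtain ⟨⟨h0, h1, h2⟩, h3⟩ := hp
    refine ⟨⟨?_, ?_, ?_⟩, ?_⟩ <;> linarith
  refine le_trans ?_ (measure_mono hsub)
  rw [volume_preimage_matrix _ (by intro h0; norm_num [h0] at hdet), hdet, measure_vadd]
  have h6 : ENNReal.ofReal (1 / 6) ≤ volume halfOpenSimplex := by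
    have h := one_le_volume_halfOpenSimplex
    rw [one_div, ENNReal.ofReal_inv_of_pos (by norm_num), ENNReal.ofReal_ofNat]
    rw [ENNReal.inv_le_iff_le_mul (by simp) (by simp)]
    exact h
  calc ENNReal.ofReal (9 / 1372) = ENNReal.ofReal (27 / 686) * ENNReal.ofReal (1 / 6) := by
        rw [← ENNReal.ofReal_mul (by norm_num)]; norm_num
    _ ≤ _ := by gcongr

/-- If the part of `D` in `w + C` has volume at least `c` for all `w ∈ W`, then Fubini for the pairs
`(w, q) ∈ W × D` with `q - w ∈ C` bounds the volume of `W`. -/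
theorem mul_volume_le_of_forall_le_volume_inter {n : ℕ} {W D C : Set (EuclideanSpace ℝ (Fin n))}
    (hW : MeasurableSet W) (hC : MeasurableSet C) {c : ℝ≥0∞}
    (h : ∀ w ∈ W, c ≤ volume (D ∩ {q | q - w ∈ C})) :
    c * volume W ≤ volume C * volume D := by
  have hmeas : Measurable (fun z : EuclideanSpace ℝ (Fin n) × EuclideanSpace ℝ (Fin n) =>
      C.indicator (1 : EuclideanSpace ℝ (Fin n) → ℝ≥0∞) (z.2 - z.1)) :=
    (measurable_one.indicator hC).comp (measurable_snd.sub measurable_fst)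
  calc c * volume W = ∫⁻ _ in W, c := by simp
    _ ≤ ∫⁻ w in W, ∫⁻ q in D, C.indicator 1 (q - w) := by
        refine setLIntegral_mono' hW fun w hw => (h w hw).trans_eq ?_
        have hm : MeasurableSet {q : EuclideanSpace ℝ (Fin n) | q - w ∈ C} :=
          (measurable_id.sub_const w) hC
        have : ∀ q, C.indicator (1 : EuclideanSpace ℝ (Fin n) → ℝ≥0∞) (q - w) =
            {q | q - w ∈ C}.indicator 1 q :=
          fun q => rfl
        simp_rw [this]
        rw [lintegral_indicator_one hm, Measure.restrict_apply hm, inter_comm]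
    _ = ∫⁻ q in D, ∫⁻ w in W, C.indicator 1 (q - w) :=
        lintegral_lintegral_swap hmeas.aemeasurable
    _ ≤ ∫⁻ _ in D, volume C := by
        refine lintegral_mono fun q => (setLIntegral_le_lintegral _ _).trans_eq ?_
        rw [lintegral_sub_left_eq_self (C.indicator 1), lintegral_indicator_one hC]
    _ = volume C * volume D := by simp

/-! ### Multiplicities -/

/-- The number of translates `x + cornerSimplex`, `x ∈ X`, which contain `p`. -/
noncomputable def coverMult (X : Set (EuclideanSpace ℝ (Fin 3)))
    (p : EuclideanSpace ℝ (Fin 3)) : ℝ≥0∞ :=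
  ∑' x : X, ((x : EuclideanSpace ℝ (Fin 3)) +ᵥ cornerSimplex).indicator 1 p

theorem two_le_coverMult {X : Set (EuclideanSpace ℝ (Fin 3))}
    {p y y' : EuclideanSpace ℝ (Fin 3)} (hy : y ∈ X) (hy' : y' ∈ X) (hne : y ≠ y')
    (hp : p ∈ y +ᵥ cornerSimplex) (hp' : p ∈ y' +ᵥ cornerSimplex) : 2 ≤ coverMult X p := by
  classical
  refine le_trans ?_ (ENNReal.sum_le_tsum {(⟨y, hy⟩ : X), ⟨y', hy'⟩})
  rw [Finset.sum_pair (by simpa using hne), indicator_of_mem hp, indicator_of_mem hp']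
  norm_num

/-- Among the translates containing `p`, one with an apex of maximal height does not contain `p` in
its overlapped part. -/
theorem one_add_overlapped_le_coverMult {X : Set (EuclideanSpace ℝ (Fin 3))}
    {p : EuclideanSpace ℝ (Fin 3)} (hp : ∃ x ∈ X, p ∈ x +ᵥ cornerSimplex) :
    1 + ∑' x : X, (overlapped X x).indicator 1 p ≤ coverMult X p := by
  by_cases htop : coverMult X p = ⊤
  · simp [htop]
  have hfin : {x : X | p ∈ (x : EuclideanSpace ℝ (Fin 3)) +ᵥ cornerSimplex}.Finite := by
    refine (ENNReal.finite_const_le_of_tsum_ne_top htop one_ne_zero).subset fun x hx => ?_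
    rw [mem_ofPred_eq, indicator_of_mem (by exact hx)]
    simp
  obtain ⟨x, hx, hxp⟩ := hp
  obtain ⟨x₀, hx₀, hmax⟩ := hfin.exists_maximalFor (fun x : X => height x) _ ⟨⟨x, hx⟩, hxp⟩
  have hnot : p ∉ overlapped X x₀ := by
    rintro ⟨-, y, hy, hlt, hpy⟩
    exact absurd (hmax (j := ⟨y, hy⟩) hpy hlt.le) (not_le.2 hlt)
  have hsplit : ∀ x : X, ((x : EuclideanSpace ℝ (Fin 3)) +ᵥ cornerSimplex).indicator
      (1 : EuclideanSpace ℝ (Fin 3) → ℝ≥0∞) p = (((x : EuclideanSpace ℝ (Fin 3)) +ᵥ cornerSimplex) \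
        overlapped X x).indicator 1 p + (overlapped X x).indicator 1 p := by
    intro x
    by_cases h : p ∈ overlapped X x
    · have h' : p ∈ (x : EuclideanSpace ℝ (Fin 3)) +ᵥ cornerSimplex := h.1
      simp [h, h']
    · by_cases h' : p ∈ (x : EuclideanSpace ℝ (Fin 3)) +ᵥ cornerSimplex
      · simp [h, h']
      · simp [h, h']
  rw [coverMult, tsum_congr hsplit, ENNReal.tsum_add]
  gcongr
  refine le_trans ?_ (ENNReal.le_tsum x₀)
  have hmem : p ∈ ((x₀ : EuclideanSpace ℝ (Fin 3)) +ᵥ cornerSimplex) \ overlapped X x₀ :=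
    ⟨hx₀, hnot⟩
  rw [indicator_of_mem hmem]
  simp

theorem mem_box_of_mem_doubleRegion {v : EuclideanSpace ℝ (Fin 3)} (hv : v ∈ doubleRegion)
    (i : Fin 3) : 3 / 14 ≤ v i ∧ v i ≤ 9 / 14 := by
  obtain ⟨h, h'⟩ := hv
  have h0 := h 0
  have h1 := h 1
  have h2 := h 2
  have hh : height v = v 0 + v 1 + v 2 := rfl
  fin_cases i <;> simp only [Fin.zero_eta, Fin.mk_one, Fin.reduceFinMk] <;> constructor <;> linarith

theorem mem_box_of_mem_cornerSimplex {x p : EuclideanSpace ℝ (Fin 3)}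
    (h : p ∈ x +ᵥ cornerSimplex) (i : Fin 3) : x i ≤ p i ∧ p i ≤ x i + 1 := by
  obtain ⟨h, h'⟩ := mem_vadd_cornerSimplex.1 h
  have h0 := h 0
  have h1 := h 1
  have h2 := h 2
  simp only [height] at h'
  fin_cases i <;> simp only [Fin.zero_eta, Fin.mk_one, Fin.reduceFinMk] <;> constructor <;> linarith

/-! ### The density bound for the corner simplex -/

/-- The density bound in a bounded form: the translates by a countable set `X` cover `D`, and `G`
lies in `D` with a margin of `1` in every coordinate. -/
theorem volume_mul_le_tsum_volume_inter {X G D : Set (EuclideanSpace ℝ (Fin 3))}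
    (hX : X.Countable) (hG : MeasurableSet G) (hD : MeasurableSet D)
    (hGD : ∀ g ∈ G, ∀ q : EuclideanSpace ℝ (Fin 3), (∀ i, |q i - g i| ≤ 1) → q ∈ D)
    (hcov : ∀ p ∈ D, ∃ x ∈ X, p ∈ x +ᵥ cornerSimplex) :
    ENNReal.ofReal (1 + 9 / 7087) * volume G ≤
      ∑' x : X, volume (D ∩ ((x : EuclideanSpace ℝ (Fin 3)) +ᵥ cornerSimplex)) := by
  have hXc : Countable X := hX.to_subtype
  have hmeas : Measurable (coverMult X) := Measurable.tsum fun x =>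
    measurable_one.indicator (measurableSet_vadd_cornerSimplex _)
  set E := ∫⁻ p in D, (coverMult X p - 1) with hE
  have hone : ∀ p ∈ D, 1 ≤ coverMult X p := fun p hp =>
    le_self_add.trans (one_add_overlapped_le_coverMult (hcov p hp))
  have htotal : ∑' x : X, volume (D ∩ ((x : EuclideanSpace ℝ (Fin 3)) +ᵥ cornerSimplex)) =
      volume D + E := by
    have h1 : ∫⁻ p in D, coverMult X p = volume D + E := by
      rw [hE, ← setLIntegral_one, ← lintegral_add_left measurable_const]
      refine setLIntegral_congr_fun hD fun p hp => ?_
      exact (add_tsub_cancel_of_le (hone p hp)).symm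
    rw [← h1]
    unfold coverMult
    rw [lintegral_tsum fun x =>
      (measurable_one.indicator (measurableSet_vadd_cornerSimplex _)).aemeasurable]
    refine tsum_congr fun x => ?_
    rw [lintegral_indicator_one (measurableSet_vadd_cornerSimplex _),
      Measure.restrict_apply (measurableSet_vadd_cornerSimplex _), inter_comm]
  have hcube : ∀ x g q : EuclideanSpace ℝ (Fin 3), g ∈ G → g ∈ x +ᵥ cornerSimplex →
      (∀ i, x i ≤ q i ∧ q i ≤ x i + 1) → q ∈ D := by
    intro x g q hg hgx hq
    refine hGD g hg q fun i => ?_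
    have h1 := mem_box_of_mem_cornerSimplex hgx i
    have h2 := hq i
    rw [abs_le]
    constructor <;> linarith
  -- The translates meeting `G` are split according to the size of their overlapped part.
  let A : Set (EuclideanSpace ℝ (Fin 3)) :=
    {x ∈ X | (∃ g ∈ G, g ∈ x +ᵥ cornerSimplex) ∧
      volume cornerSimplex ≤ 343 * volume (overlapped X x)}
  let B : Set (EuclideanSpace ℝ (Fin 3)) :=
    {x ∈ X | (∃ g ∈ G, g ∈ x +ᵥ cornerSimplex) ∧
      ¬ volume cornerSimplex ≤ 343 * volume (overlapped X x)}
  have hA : volume (⋃ x ∈ A, x +ᵥ cornerSimplex) ≤ 343 * E := by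
    have hAc : A.Countable := hX.mono fun x hx => hx.1
    calc volume (⋃ x ∈ A, x +ᵥ cornerSimplex)
        ≤ ∑' x : A, volume ((x : EuclideanSpace ℝ (Fin 3)) +ᵥ cornerSimplex) :=
          measure_biUnion_le _ hAc _
      _ ≤ ∑' x : A, 343 * ∫⁻ p in D, (overlapped X x).indicator 1 p := by
          refine ENNReal.tsum_le_tsum fun x => ?_
          obtain ⟨x, hx, ⟨g, hg, hgx⟩, hvol⟩ := x
          rw [measure_vadd, lintegral_indicator_one (measurableSet_overlapped hX x),
            Measure.restrict_apply (measurableSet_overlapped hX x), inter_eq_left.2]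
          · exact hvol
          · exact fun p hp => hcube x g p hg hgx (mem_box_of_mem_cornerSimplex hp.1)
      _ ≤ ∑' x : X, 343 * ∫⁻ p in D, (overlapped X x).indicator 1 p :=
          ENNReal.tsum_mono_subtype (fun x => 343 * ∫⁻ p in D, (overlapped X x).indicator 1 p)
            fun x hx => hx.1
      _ = 343 * ∫⁻ p in D, ∑' x : X, (overlapped X x).indicator 1 p := by
          rw [ENNReal.tsum_mul_left, lintegral_tsum fun x =>
            (measurable_one.indicator (measurableSet_overlapped hX _)).aemeasurable]
      _ ≤ 343 * E := by
          gcongr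
          refine setLIntegral_mono' hD fun p hp => ?_
          exact ENNReal.le_sub_of_add_le_left ENNReal.one_ne_top
            (one_add_overlapped_le_coverMult (hcov p hp))
  let D₂ := {p ∈ D | 2 ≤ coverMult X p}
  have hD₂m : MeasurableSet D₂ := hD.inter (measurableSet_le measurable_const hmeas)
  have hD₂ : volume D₂ ≤ E := by
    rw [← setLIntegral_one]
    refine (setLIntegral_mono' hD₂m fun p hp => ?_).trans (lintegral_mono_set fun p hp => hp.1)
    refine ENNReal.le_sub_of_add_le_left ENNReal.one_ne_top ?_
    rw [one_add_one_eq_two]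
    exact hp.2
  let W := G ∩ ⋃ x ∈ B, x +ᵥ cornerSimplex
  have hWm : MeasurableSet W := hG.inter (.biUnion (hX.mono fun x hx => hx.1)
    fun x _ => measurableSet_vadd_cornerSimplex x)
  have hW : volume W ≤ ENNReal.ofReal (4000 / 9) * E := by
    -- By the dichotomy, the points above a translate of the second kind are covered twice.
    have hBU : ∀ x ∈ B, x +ᵥ doubleRegion ⊆ D₂ := by
      rintro x ⟨hx, ⟨g, hg, hgx⟩, hvol⟩ _ ⟨v, hv, rfl⟩
      refine ⟨hcube x g _ hg hgx fun i => ?_, ?_⟩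
      · have := mem_box_of_mem_doubleRegion hv i
        simp only [vadd_eq_add, PiLp.add_apply]
        constructor <;> linarith
      rcases overlap_or_covered_twice (X := X) (x := x)
        (fun q hq => hcov q (hcube x g q hg hgx hq)) hv with ⟨y, hy, hxy, h⟩ |
        ⟨y, hy, y', hy', hne, hp, hp'⟩
      · exact absurd (volume_overlapped hy hxy h) hvol
      · exact two_le_coverMult hy hy' hne hp hp'
    have hC := volume_box (-11 / 14) (9 / 14)
    have hCm : MeasurableSet
        {p : EuclideanSpace ℝ (Fin 3) | ∀ i, p i ∈ Icc (-11 / 14 : ℝ) (9 / 14)} := by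
      have : {p : EuclideanSpace ℝ (Fin 3) | ∀ i, p i ∈ Icc (-11 / 14 : ℝ) (9 / 14)} =
          ⋂ i, {p | p i ∈ Icc (-11 / 14 : ℝ) (9 / 14)} := by ext; simp
      rw [this]
      exact .iInter fun i => measurableSet_Icc.preimage (by fun_prop)
    have hmain := mul_volume_le_of_forall_le_volume_inter (c := ENNReal.ofReal (9 / 1372))
      hWm hCm (by
        rintro w ⟨-, hw⟩
        simp only [mem_iUnion] at hw
        obtain ⟨x, hxB, hwx⟩ := hw
        refine volume_doubleRegion.trans ?_
        rw [← measure_vadd volume x]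
        refine measure_mono fun p hp => ⟨hBU x hxB hp, fun i => ?_⟩
        obtain ⟨v, hv, rfl⟩ := hp
        have h1 := mem_box_of_mem_doubleRegion hv i
        have h2 := mem_box_of_mem_cornerSimplex hwx i
        simp only [vadd_eq_add, PiLp.add_apply, PiLp.sub_apply]
        constructor <;> linarith)
    rw [hC, ← ENNReal.ofReal_pow (by norm_num)] at hmain
    calc volume W = ENNReal.ofReal (1372 / 9) * (ENNReal.ofReal (9 / 1372) * volume W) := by
          rw [← mul_assoc, ← ENNReal.ofReal_mul (by norm_num)]; norm_num
      _ ≤ ENNReal.ofReal (1372 / 9) * (ENNReal.ofReal ((9 / 14 - -11 / 14) ^ 3) * E) := by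
          exact mul_le_mul_right (hmain.trans (mul_le_mul_right hD₂ _)) _
      _ = ENNReal.ofReal (4000 / 9) * E := by
          rw [← mul_assoc, ← ENNReal.ofReal_mul (by norm_num)]; norm_num
  have hGle : volume G ≤ ENNReal.ofReal (7087 / 9) * E := by
    have hsub : G ⊆ (⋃ x ∈ A, x +ᵥ cornerSimplex) ∪ W := by
      intro g hg
      have hgD : g ∈ D := hGD g hg g (by simp)
      obtain ⟨x, hx, hgx⟩ := hcov g hgD
      by_cases hvol : volume cornerSimplex ≤ 343 * volume (overlapped X x)
      · exact .inl (mem_biUnion (show x ∈ A from ⟨hx, ⟨g, hg, hgx⟩, hvol⟩) hgx)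
      · exact .inr ⟨hg, mem_biUnion (show x ∈ B from ⟨hx, ⟨g, hg, hgx⟩, hvol⟩) hgx⟩
    calc volume G ≤ 343 * E + ENNReal.ofReal (4000 / 9) * E :=
          (measure_mono hsub).trans ((measure_union_le _ _).trans (add_le_add hA hW))
      _ = ENNReal.ofReal (7087 / 9) * E := by
          have : (343 : ℝ≥0∞) = ENNReal.ofReal 343 := by norm_num
          rw [this, ← add_mul, ← ENNReal.ofReal_add (by norm_num) (by norm_num)]
          norm_num
  rw [htotal, ENNReal.ofReal_add (by norm_num) (by norm_num), add_mul, ENNReal.ofReal_one, one_mul]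
  refine add_le_add (measure_mono fun g hg => hGD g hg g (by simp)) ?_
  calc ENNReal.ofReal (9 / 7087) * volume G
      ≤ ENNReal.ofReal (9 / 7087) * (ENNReal.ofReal (7087 / 9) * E) := by gcongr
    _ = E := by
        rw [← mul_assoc, ← ENNReal.ofReal_mul (by norm_num)]; norm_num

theorem volume_cornerSimplex_ne_zero : volume cornerSimplex ≠ 0 := by
  have hsub : halfOpenSimplex ⊆ cornerSimplex := fun p hp => ⟨hp.1, hp.2.le⟩
  intro h
  have := one_le_volume_halfOpenSimplex
  rw [measure_mono_null hsub h] at this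
  simp at this

/-- The bounded form of the density bound without a countability assumption: if the sum is finite,
only countably many translates meet `D'` in positive volume, and these include all that meet `D`. -/
theorem volume_mul_le_of_isTranslativeCovering {X G D D' : Set (EuclideanSpace ℝ (Fin 3))}
    (hX : IsTranslativeCovering cornerSimplex X) (hG : MeasurableSet G) (hD : MeasurableSet D)
    (hGD : ∀ g ∈ G, ∀ q : EuclideanSpace ℝ (Fin 3), (∀ i, |q i - g i| ≤ 1) → q ∈ D)
    (hDD' : ∀ g ∈ D, ∀ q : EuclideanSpace ℝ (Fin 3), (∀ i, |q i - g i| ≤ 1) → q ∈ D') :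
    ENNReal.ofReal (1 + 9 / 7087) * volume G ≤
      ∑' x : X, volume (D' ∩ ((x : EuclideanSpace ℝ (Fin 3)) +ᵥ cornerSimplex)) := by
  by_cases htop :
    ∑' x : X, volume (D' ∩ ((x : EuclideanSpace ℝ (Fin 3)) +ᵥ cornerSimplex)) = ⊤
  · simp [htop]
  let X₀ := {x ∈ X | volume (D' ∩ (x +ᵥ cornerSimplex)) ≠ 0}
  have hX₀ : X₀.Countable := by
    refine ((Summable.countable_support_ennreal htop).image Subtype.val).mono ?_
    rintro x ⟨hx, hne⟩
    exact ⟨⟨x, hx⟩, hne, rfl⟩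
  have hcov : ∀ p ∈ D, ∃ x ∈ X₀, p ∈ x +ᵥ cornerSimplex := by
    intro p hp
    have hp' : p ∈ ⋃ x ∈ X, x +ᵥ cornerSimplex := by rw [hX]; trivial
    simp only [mem_iUnion] at hp'
    obtain ⟨x, hx, hpx⟩ := hp'
    refine ⟨x, ⟨hx, ?_⟩, hpx⟩
    rw [inter_eq_right.2, measure_vadd]
    · exact volume_cornerSimplex_ne_zero
    · intro q hq
      refine hDD' p hp q fun i => ?_
      have h1 := mem_box_of_mem_cornerSimplex hpx i
      have h2 := mem_box_of_mem_cornerSimplex hq i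
      rw [abs_le]
      constructor <;> linarith
  have hDsub : D ⊆ D' := fun p hp => hDD' p hp p (by simp)
  calc ENNReal.ofReal (1 + 9 / 7087) * volume G
      ≤ ∑' x : X₀, volume (D ∩ ((x : EuclideanSpace ℝ (Fin 3)) +ᵥ cornerSimplex)) :=
        volume_mul_le_tsum_volume_inter hX₀ hG hD hGD hcov
    _ ≤ ∑' x : X₀, volume (D' ∩ ((x : EuclideanSpace ℝ (Fin 3)) +ᵥ cornerSimplex)) :=
        ENNReal.tsum_le_tsum fun x => measure_mono (inter_subset_inter_left _ hDsub)
    _ ≤ _ := ENNReal.tsum_mono_subtype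
        (fun x => volume (D' ∩ (x +ᵥ cornerSimplex))) fun x hx => hx.1

/-! ### Linear images of coverings -/

section Transfer

variable {n : ℕ} (L : EuclideanSpace ℝ (Fin n) ≃ₗ[ℝ] EuclideanSpace ℝ (Fin n))
  (b : EuclideanSpace ℝ (Fin n)) (K X D : Set (EuclideanSpace ℝ (Fin n)))

/-- The map `x ↦ L x - b`, which takes translation vectors for `K` to translation vectors for
`b + L K`, in such a way that `x + K` is mapped by `L` to the corresponding translate. -/
def shiftedEquiv : EuclideanSpace ℝ (Fin n) ≃ EuclideanSpace ℝ (Fin n) :=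
  L.toEquiv.trans (Equiv.subRight b)

theorem shiftedEquiv_apply (x : EuclideanSpace ℝ (Fin n)) : shiftedEquiv L b x = L x - b := rfl

theorem shiftedEquiv_vadd (x : EuclideanSpace ℝ (Fin n)) :
    shiftedEquiv L b x +ᵥ (b +ᵥ L '' K) = L '' (x +ᵥ K) := by
  rw [vadd_vadd]
  ext p
  simp only [mem_vadd_set, mem_image, shiftedEquiv_apply, vadd_eq_add]
  constructor
  · rintro ⟨_, ⟨k, hk, rfl⟩, rfl⟩
    exact ⟨_, ⟨k, hk, rfl⟩, by simp⟩
  · rintro ⟨_, ⟨k, hk, rfl⟩, rfl⟩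
    exact ⟨_, ⟨k, hk, rfl⟩, by simp⟩

theorem isTranslativeCovering_image_iff :
    IsTranslativeCovering (b +ᵥ L '' K) (shiftedEquiv L b '' X) ↔ IsTranslativeCovering K X := by
  unfold IsTranslativeCovering
  rw [biUnion_image]
  simp_rw [shiftedEquiv_vadd]
  rw [← image_iUnion₂]
  have h := L.injective.image_injective.eq_iff (a := ⋃ x ∈ X, x +ᵥ K) (b := univ)
  rwa [image_univ_of_surjective L.surjective] at h

theorem relativeDensity_image :
    relativeDensity (b +ᵥ L '' K) (shiftedEquiv L b '' X) (L '' D) = relativeDensity K X D := by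
  have hdet : ENNReal.ofReal |LinearMap.det (L : EuclideanSpace ℝ (Fin n) →ₗ[ℝ] _)| ≠ 0 := by
    simpa using L.isUnit_det'.ne_zero
  have hvol : ∀ S : Set (EuclideanSpace ℝ (Fin n)), volume (L '' S) =
      ENNReal.ofReal |LinearMap.det (L : EuclideanSpace ℝ (Fin n) →ₗ[ℝ] _)| * volume S :=
    fun S => Measure.addHaar_image_linearMap volume (L : EuclideanSpace ℝ (Fin n) →ₗ[ℝ] _) S
  unfold relativeDensity
  rw [← ((shiftedEquiv L b).image X).tsum_eq]
  simp only [Equiv.image_apply_coe, shiftedEquiv_vadd, ← image_inter L.injective, hvol,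
    ENNReal.tsum_mul_left]
  exact ENNReal.mul_div_mul_left _ _ hdet ENNReal.ofReal_ne_top

/-- Similarities preserve the translative covering density: they take balls about the origin to
balls about the origin, since the translation part is absorbed in the translation vectors. -/
theorem translativeCoveringDensity_image {c : ℝ} (hc : 0 < c) (hL : ∀ u, ‖L u‖ = c * ‖u‖) :
    translativeCoveringDensity (b +ᵥ L '' K) = translativeCoveringDensity K := by
  have hball : ∀ r, L '' Metric.closedBall 0 r = Metric.closedBall 0 (c * r) := by
    intro r
    ext p
    obtain ⟨u, rfl⟩ := L.surjective p
    rw [L.injective.mem_set_image]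
    simp [hL, hc]
  have hdens : ∀ X, translativeDensity (b +ᵥ L '' K) (shiftedEquiv L b '' X) =
      translativeDensity K X := by
    intro X
    unfold translativeDensity
    have hmap : map (fun r : ℝ => c * r) atTop = atTop := (OrderIso.mulLeft₀ c hc).map_atTop
    conv_lhs => rw [← hmap]
    rw [← liminf_comp]
    congr 1
    ext r
    simp only [Function.comp_apply]
    rw [← hball, relativeDensity_image]
  unfold translativeCoveringDensity
  refine ((Equiv.Set.congr (shiftedEquiv L b)).iInf_congr fun X => ?_).symm
  simp only [Equiv.Set.congr_apply, isTranslativeCovering_image_iff, hdens]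

end Transfer

/-! ### Regular tetrahedra -/

/-- The linear map taking the standard basis to the edge vectors of the simplex `v` at `v 0`. -/
noncomputable def edgeMap (v : Fin 4 → EuclideanSpace ℝ (Fin 3)) :
    EuclideanSpace ℝ (Fin 3) →ₗ[ℝ] EuclideanSpace ℝ (Fin 3) :=
  Fintype.linearCombination ℝ (fun i : Fin 3 => v i.succ - v 0) ∘ₗ
    (WithLp.linearEquiv 2 ℝ (Fin 3 → ℝ)).toLinearMap

theorem edgeMap_apply (v : Fin 4 → EuclideanSpace ℝ (Fin 3)) (u : EuclideanSpace ℝ (Fin 3)) :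
    edgeMap v u = u 0 • (v 1 - v 0) + u 1 • (v 2 - v 0) + u 2 • (v 3 - v 0) := by
  simp [edgeMap, Fintype.linearCombination_apply, Fin.sum_univ_three]

theorem convexHull_range_eq (v : Fin 4 → EuclideanSpace ℝ (Fin 3)) :
    convexHull ℝ (range v) = v 0 +ᵥ edgeMap v '' cornerSimplex := by
  apply subset_antisymm
  · refine convexHull_min ?_ ?_
    · rintro _ ⟨i, rfl⟩
      refine Fin.cases ?_ (fun i => ?_) i
      · refine ⟨_, ⟨0, ⟨by simp, by simp [height]⟩, rfl⟩, by simp⟩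
      · refine ⟨_, ⟨EuclideanSpace.single i 1, ⟨fun j => ?_, ?_⟩, rfl⟩, ?_⟩
        · simp only [PiLp.single_apply]
          split_ifs <;> norm_num
        · fin_cases i <;> simp [height]
        · simp only [edgeMap_apply]
          fin_cases i <;> simp
    · refine Convex.vadd ?_ _
      refine Convex.linear_image ?_ _
      intro p hp q hq s t hs ht hst
      refine ⟨fun i => ?_, ?_⟩
      · have := mul_nonneg hs (hp.1 i)
        have := mul_nonneg ht (hq.1 i)
        simp only [PiLp.add_apply, PiLp.smul_apply, smul_eq_mul]
        linarith
      · have h1 := mul_le_mul_of_nonneg_left hp.2 hs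
        have h2 := mul_le_mul_of_nonneg_left hq.2 ht
        simp only [height, PiLp.add_apply, PiLp.smul_apply, smul_eq_mul] at h1 h2 ⊢
        linarith
  · rintro _ ⟨_, ⟨u, ⟨hu, hu1⟩, rfl⟩, rfl⟩
    have h := (convex_convexHull ℝ (range v)).sum_mem (t := Finset.univ)
      (w := ![1 - height u, u 0, u 1, u 2]) (z := v)
      (by
        intro i _
        fin_cases i
        · simpa using hu1
        · exact hu 0
        · exact hu 1
        · exact hu 2)
      (by simp [Fin.sum_univ_four, height]; ring)
      (fun i _ => subset_convexHull ℝ _ ⟨i, rfl⟩)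
    convert h using 1
    simp only [edgeMap_apply, vadd_eq_add, Fin.sum_univ_four, Matrix.cons_val, height]
    module

/-- The norm of an edge combination depends only on the common edge length, so that edge maps of
regular tetrahedra differ by similarities. -/
theorem norm_edgeMap_sq {v : Fin 4 → EuclideanSpace ℝ (Fin 3)} {a : ℝ}
    (hv : ∀ i j, i ≠ j → dist (v i) (v j) = a) (u : EuclideanSpace ℝ (Fin 3)) :
    ‖edgeMap v u‖ ^ 2 =
      a ^ 2 * (u 0 ^ 2 + u 1 ^ 2 + u 2 ^ 2 + u 0 * u 1 + u 1 * u 2 + u 0 * u 2) := by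
  have hnorm : ∀ i : Fin 4, i ≠ 0 → inner ℝ (v i - v 0) (v i - v 0) = a ^ 2 := by
    intro i hi
    rw [real_inner_self_eq_norm_sq, ← dist_eq_norm, hv i 0 hi]
  have hinner : ∀ i j : Fin 4, i ≠ 0 → j ≠ 0 → i ≠ j →
      inner ℝ (v i - v 0) (v j - v 0) = a ^ 2 / 2 := by
    intro i j hi hj hij
    rw [real_inner_eq_norm_mul_self_add_norm_mul_self_sub_norm_sub_mul_self_div_two,
      sub_sub_sub_cancel_right, ← dist_eq_norm, ← dist_eq_norm, ← dist_eq_norm, hv i 0 hi,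
      hv j 0 hj, hv i j hij]
    ring
  rw [edgeMap_apply, ← real_inner_self_eq_norm_sq]
  simp only [inner_add_left, inner_add_right, real_inner_smul_left, real_inner_smul_right]
  rw [hnorm 1 (by decide), hnorm 2 (by decide), hnorm 3 (by decide),
    hinner 1 2 (by decide) (by decide) (by decide), hinner 2 1 (by decide) (by decide) (by decide),
    hinner 1 3 (by decide) (by decide) (by decide), hinner 3 1 (by decide) (by decide) (by decide),
    hinner 2 3 (by decide) (by decide) (by decide), hinner 3 2 (by decide) (by decide) (by decide)]
  ring

theorem edgeMap_injective {v : Fin 4 → EuclideanSpace ℝ (Fin 3)} {a : ℝ} (ha : a ≠ 0)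
    (hv : ∀ i j, i ≠ j → dist (v i) (v j) = a) : Function.Injective (edgeMap v) := by
  rw [← LinearMap.ker_eq_bot, LinearMap.ker_eq_bot']
  intro u hu
  have h := norm_edgeMap_sq hv u
  rw [hu, norm_zero, zero_pow two_ne_zero, eq_comm, mul_eq_zero] at h
  have h := h.resolve_left (pow_ne_zero 2 ha)
  have hsum : u 0 ^ 2 + u 1 ^ 2 + u 2 ^ 2 + (u 0 + u 1 + u 2) ^ 2 = 0 := by linarith
  have h0 : u 0 = 0 := by
    refine pow_eq_zero_iff two_ne_zero |>.1 (le_antisymm ?_ (sq_nonneg _))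
    linarith [sq_nonneg (u 1), sq_nonneg (u 2), sq_nonneg (u 0 + u 1 + u 2)]
  have h1 : u 1 = 0 := by
    refine pow_eq_zero_iff two_ne_zero |>.1 (le_antisymm ?_ (sq_nonneg _))
    linarith [sq_nonneg (u 0), sq_nonneg (u 2), sq_nonneg (u 0 + u 1 + u 2)]
  have h2 : u 2 = 0 := by
    refine pow_eq_zero_iff two_ne_zero |>.1 (le_antisymm ?_ (sq_nonneg _))
    linarith [sq_nonneg (u 0), sq_nonneg (u 1), sq_nonneg (u 0 + u 1 + u 2)]
  ext i
  fin_cases i <;> simp [h0, h1, h2]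

theorem exists_edgeEquiv {v : Fin 4 → EuclideanSpace ℝ (Fin 3)} {a : ℝ} (ha : a ≠ 0)
    (hv : ∀ i j, i ≠ j → dist (v i) (v j) = a) :
    ∃ L : EuclideanSpace ℝ (Fin 3) ≃ₗ[ℝ] EuclideanSpace ℝ (Fin 3),
      convexHull ℝ (range v) = v 0 +ᵥ L '' cornerSimplex ∧
      ∀ u, ‖L u‖ ^ 2 =
        a ^ 2 * (u 0 ^ 2 + u 1 ^ 2 + u 2 ^ 2 + u 0 * u 1 + u 1 * u 2 + u 0 * u 2) :=
  ⟨LinearEquiv.ofInjectiveEndo (edgeMap v) (edgeMap_injective ha hv), convexHull_range_eq v,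
    norm_edgeMap_sq hv⟩

theorem translativeCoveringDensity_eq_of_edges {v w : Fin 4 → EuclideanSpace ℝ (Fin 3)}
    {a b : ℝ} (ha : 0 < a) (hb : 0 < b) (hv : ∀ i j, i ≠ j → dist (v i) (v j) = a)
    (hw : ∀ i j, i ≠ j → dist (w i) (w j) = b) :
    translativeCoveringDensity (convexHull ℝ (range v)) =
      translativeCoveringDensity (convexHull ℝ (range w)) := by
  obtain ⟨L, hL, hLn⟩ := exists_edgeEquiv ha.ne' hv
  obtain ⟨M, hM, hMn⟩ := exists_edgeEquiv hb.ne' hw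
  have hK : convexHull ℝ (range v) =
      (v 0 - L (M.symm (w 0))) +ᵥ (M.symm.trans L) '' (convexHull ℝ (range w)) := by
    rw [hL, hM]
    ext p
    simp only [mem_vadd_set, mem_image, vadd_eq_add, LinearEquiv.trans_apply]
    constructor
    · rintro ⟨_, ⟨u, hu, rfl⟩, rfl⟩
      refine ⟨_, ⟨_, ⟨_, ⟨u, hu, rfl⟩, rfl⟩, rfl⟩, ?_⟩
      simp only [map_add, LinearEquiv.symm_apply_apply]
      abel
    · rintro ⟨_, ⟨_, ⟨_, ⟨u, hu, rfl⟩, rfl⟩, rfl⟩, rfl⟩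
      refine ⟨_, ⟨u, hu, rfl⟩, ?_⟩
      simp only [map_add, LinearEquiv.symm_apply_apply]
      abel
  rw [hK]
  refine translativeCoveringDensity_image _ _ _ (c := a / b) (by positivity) fun u => ?_
  obtain ⟨u, rfl⟩ := M.surjective u
  rw [← sq_eq_sq₀ (by positivity) (by positivity), mul_pow, hMn, LinearEquiv.trans_apply,
    LinearEquiv.symm_apply_apply, hLn]
  field_simp

/-! ### The density bound for all simplices -/

theorem sqrt_two_div_lt : Real.sqrt 2 / 1152 < 9 / 7087 := by
  have : Real.sqrt 2 < 1.415 := by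
    rw [Real.sqrt_lt' (by norm_num)]; norm_num
  linarith

theorem eventually_mul_pow_le {c c' : ℝ} (h : c < c') (a : ℝ) :
    ∀ᶠ r : ℝ in atTop, c * r ^ 3 ≤ c' * (r - a) ^ 3 := by
  have hlim : Tendsto (fun r : ℝ => c' * (1 - a / r) ^ 3) atTop (nhds (c' * (1 - 0) ^ 3)) :=
    ((tendsto_const_nhds.sub (tendsto_const_nhds.div_atTop tendsto_id)).pow 3).const_mul c'
  filter_upwards [hlim.eventually (lt_mem_nhds (a := c) (by simpa using h)), eventually_gt_atTop 0]
    with r hr hr0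
  calc c * r ^ 3 ≤ c' * (1 - a / r) ^ 3 * r ^ 3 := by gcongr
    _ = c' * (r - a) ^ 3 := by
      rw [mul_assoc, ← mul_pow]; congr 2; field_simp

theorem le_translativeDensity_image (L : EuclideanSpace ℝ (Fin 3) ≃ₗ[ℝ] EuclideanSpace ℝ (Fin 3))
    (b : EuclideanSpace ℝ (Fin 3)) {X : Set (EuclideanSpace ℝ (Fin 3))}
    (hX : IsTranslativeCovering (b +ᵥ L '' cornerSimplex) X) :
    ENNReal.ofReal (1 + Real.sqrt 2 / 1152) ≤
      translativeDensity (b +ᵥ L '' cornerSimplex) X := by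
  obtain ⟨Y, rfl⟩ : ∃ Y, X = shiftedEquiv L b '' Y :=
    ⟨_, ((shiftedEquiv L b).image_preimage X).symm⟩
  rw [isTranslativeCovering_image_iff] at hX
  obtain ⟨M, hM⟩ : ∃ M : ℝ, ∀ u : EuclideanSpace ℝ (Fin 3), (∀ i, |u i| ≤ 1) → ‖L u‖ ≤ M := by
    let L' := LinearMap.toContinuousLinearMap
      (L : EuclideanSpace ℝ (Fin 3) →ₗ[ℝ] EuclideanSpace ℝ (Fin 3))
    refine ⟨‖L'‖ * 2, fun u hu => (L'.le_opNorm u).trans ?_⟩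
    gcongr
    rw [EuclideanSpace.norm_eq, Fin.sum_univ_three, Real.sqrt_le_left (by norm_num)]
    have h0 := sq_le_one_iff_abs_le_one (u 0) |>.2 (hu 0)
    have h1 := sq_le_one_iff_abs_le_one (u 1) |>.2 (hu 1)
    have h2 := sq_le_one_iff_abs_le_one (u 2) |>.2 (hu 2)
    simp only [Real.norm_eq_abs, sq_abs]
    linarith
  have hLc : Continuous L := LinearMap.continuous_of_finiteDimensional
    (L : EuclideanSpace ℝ (Fin 3) →ₗ[ℝ] EuclideanSpace ℝ (Fin 3))
  have hmeas : ∀ s, MeasurableSet (L ⁻¹' Metric.closedBall 0 s) := fun s =>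
    (Metric.isClosed_closedBall.preimage hLc).measurableSet
  have hmargin : ∀ s, ∀ g ∈ L ⁻¹' Metric.closedBall 0 s, ∀ q : EuclideanSpace ℝ (Fin 3),
      (∀ i, |q i - g i| ≤ 1) → q ∈ L ⁻¹' Metric.closedBall 0 (s + M) := by
    intro s g hg q hq
    have h := hM (q - g) hq
    rw [map_sub] at h
    simp only [mem_preimage, mem_closedBall_zero_iff] at hg ⊢
    have := norm_le_insert' (L q) (L g)
    linarith
  have hvol : ∀ s : ℝ, 0 ≤ s → volume (L ⁻¹' Metric.closedBall 0 s) =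
      ENNReal.ofReal (s ^ 3) * volume (L ⁻¹' Metric.closedBall 0 1) := by
    intro s hs
    have hdet := Measure.addHaar_preimage_linearMap volume
      (f := (L : EuclideanSpace ℝ (Fin 3) →ₗ[ℝ] EuclideanSpace ℝ (Fin 3))) L.isUnit_det'.ne_zero
    have e : ∀ S : Set (EuclideanSpace ℝ (Fin 3)), L ⁻¹' S =
        (L : EuclideanSpace ℝ (Fin 3) →ₗ[ℝ] EuclideanSpace ℝ (Fin 3)) ⁻¹' S := fun S => rfl
    rw [e, e, hdet, hdet, Measure.addHaar_closedBall' _ _ hs]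
    simp only [finrank_euclideanSpace, Fintype.card_fin]
    ring
  have hlt : 1 + Real.sqrt 2 / 1152 < 1 + 9 / 7087 := by linarith [sqrt_two_div_lt]
  -- In the coordinates of the corner simplex, balls become ellipsoids; shrinking the radius by `2M`
  -- leaves the two margins required, at a cost that is negligible as `r → ∞`.
  refine le_liminf_of_le (by isBoundedDefault) ?_
  filter_upwards [eventually_mul_pow_le hlt (M + M), eventually_gt_atTop 0,
    eventually_ge_atTop (M + M)] with r hr hr0 hrM
  have himg : Metric.closedBall (0 : EuclideanSpace ℝ (Fin 3)) r =
      L '' (L ⁻¹' Metric.closedBall 0 r) := (image_preimage_eq _ L.surjective).symm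
  have hpos : volume (Metric.closedBall (0 : EuclideanSpace ℝ (Fin 3)) r) ≠ 0 :=
    (Metric.measure_closedBall_pos volume _ hr0).ne'
  rw [himg, relativeDensity_image, relativeDensity]
  rw [himg] at hpos
  have hpos' : volume (L ⁻¹' Metric.closedBall (0 : EuclideanSpace ℝ (Fin 3)) r) ≠ 0 := by
    intro h0
    apply hpos
    have := Measure.addHaar_image_linearMap volume
      (L : EuclideanSpace ℝ (Fin 3) →ₗ[ℝ] EuclideanSpace ℝ (Fin 3))
      (L ⁻¹' Metric.closedBall 0 r)
    rw [h0, mul_zero] at this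
    exact this
  have hfin : volume (L ⁻¹' Metric.closedBall (0 : EuclideanSpace ℝ (Fin 3)) r) ≠ ⊤ := by
    have e : L ⁻¹' Metric.closedBall (0 : EuclideanSpace ℝ (Fin 3)) r =
        (L : EuclideanSpace ℝ (Fin 3) →ₗ[ℝ] EuclideanSpace ℝ (Fin 3)) ⁻¹'
          Metric.closedBall 0 r := rfl
    rw [e, Measure.addHaar_preimage_linearMap volume L.isUnit_det'.ne_zero]
    exact ENNReal.mul_ne_top ENNReal.ofReal_ne_top measure_closedBall_lt_top.ne
  rw [ENNReal.le_div_iff_mul_le (.inl hpos') (.inl hfin)]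
  have hmain := volume_mul_le_of_isTranslativeCovering hX (hmeas (r - (M + M)))
    (hmeas (r - (M + M) + M)) (hmargin _) (hmargin _)
  have hr' : r - (M + M) + M + M = r := by ring
  rw [hr'] at hmain
  refine le_trans ?_ hmain
  rw [hvol r hr0.le, hvol _ (sub_nonneg.2 hrM), ← mul_assoc, ← mul_assoc,
    ← ENNReal.ofReal_mul (by positivity), ← ENNReal.ofReal_mul (by positivity)]
  gcongr

/-- The vertices of `tetrahedronT`. -/
noncomputable def tetrahedronVertex : Fin 4 → EuclideanSpace ℝ (Fin 3) :=
  ![!₂[1, 1, -1], !₂[1, -1, 1], !₂[-1, 1, 1], !₂[-1, -1, -1]]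

theorem tetrahedronT_eq : tetrahedronT = convexHull ℝ (range tetrahedronVertex) := by
  unfold tetrahedronT tetrahedronVertex
  congr 1
  simp only [Matrix.range_cons, Matrix.range_empty, union_empty, singleton_union]

theorem dist_tetrahedronVertex (i j : Fin 4) (h : i ≠ j) :
    dist (tetrahedronVertex i) (tetrahedronVertex j) = Real.sqrt 8 := by
  rw [EuclideanSpace.dist_eq]
  congr 1
  fin_cases i <;> fin_cases j <;> first | exact absurd rfl h | skip
  all_goals
    simp [tetrahedronVertex, Fin.sum_univ_three, Real.dist_eq]
    norm_num

theorem theorem1 :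
    (∀ X : Set (EuclideanSpace ℝ (Fin 3)), IsTranslativeCovering tetrahedronT X →
      ENNReal.ofReal (1 + Real.sqrt 2 / 1152) ≤ translativeDensity tetrahedronT X) ∧
    (∀ S : Set (EuclideanSpace ℝ (Fin 3)), IsUnitRegularSimplex S →
      translativeCoveringDensity tetrahedronT = translativeCoveringDensity S ∧
      ENNReal.ofReal (1 + Real.sqrt 2 / 1152) ≤ translativeCoveringDensity S) ∧
    ENNReal.ofReal (1 + Real.sqrt 2 / 1152) ≤ translativeCoveringDensity tetrahedronT ∧
    (1 : ℝ) + Real.sqrt 2 / 1152 > 1 + 1.227 * 10 ^ (-3 : ℤ) := by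
  have h8 : 0 < Real.sqrt 8 := by positivity
  have hbound : ∀ X : Set (EuclideanSpace ℝ (Fin 3)), IsTranslativeCovering tetrahedronT X →
      ENNReal.ofReal (1 + Real.sqrt 2 / 1152) ≤ translativeDensity tetrahedronT X := by
    obtain ⟨L, hL, -⟩ := exists_edgeEquiv h8.ne' dist_tetrahedronVertex
    rw [tetrahedronT_eq, hL]
    exact fun X hX => le_translativeDensity_image L _ hX
  have hinf : ENNReal.ofReal (1 + Real.sqrt 2 / 1152) ≤ translativeCoveringDensity tetrahedronT :=
    le_iInf₂ hbound
  refine ⟨hbound, ?_, hinf, ?_⟩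
  · rintro S ⟨v, hv, rfl⟩
    have heq : translativeCoveringDensity tetrahedronT =
        translativeCoveringDensity (convexHull ℝ (range v)) := by
      rw [tetrahedronT_eq]
      exact translativeCoveringDensity_eq_of_edges h8 one_pos dist_tetrahedronVertex hv
    exact ⟨heq, heq ▸ hinf⟩
  · have h : (1.4141 : ℝ) < Real.sqrt 2 := by
      rw [Real.lt_sqrt (by norm_num)]; norm_num
    norm_num
    linarith
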